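/- Let $H$ be an infinite-dimensional separable complex Hilbert space and let $k_1,k_2\in B(H)$ be nonzero positive compact operators. Write $\operatorname{tr}$ for the $[0,\infty]$-valued trace on positive operators; projections are self-adjoint idempotents. (i) $I+k_1$ is a sum of finitely many projections if and only if $k_1$ has finite rank and $\operatorname{tr}(k_1)$ is an integer. (ii) Suppose that the operator $I+(k_1\oplus -k_2)$ on $H\oplus H$ is a sum of finitely many projections. Then $k_1$ and $k_2$ generate the same two-sided (not necessarily closed) principal ideal of $B(H)$. If, moreover, $1$ is not an eigenvalue of $k_2$, then either $\operatorname{tr}(k_1)=\infty$, or $\operatorname{tr}(k_1)-\operatorname{tr}(k_2)$ is a nonnegative integer. -/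

import Mathlib

open scoped ENNReal InnerProductSpace

noncomputable section

namespace FiniteSumsOfProjections

/-- `a` is a sum of finitely many (self-adjoint, idempotent) projections of `B(H)`. -/
def IsFiniteSumOfProjections {H : Type*} [NormedAddCommGroup H] [InnerProductSpace ℂ H]
    [CompleteSpace H]
    (a : H →L[ℂ] H) : Prop :=
  ∃ (n : ℕ) (p : Fin n → (H →L[ℂ] H)), (∀ j, IsStarProjection (p j)) ∧ a = ∑ j, p j

/-- The trace `∑ᵢ ⟨eᵢ, a eᵢ⟩ ∈ [0, ∞]` of a positive operator `a`, computed in some Hilbert basis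
of `H`; it does not depend on the basis, see `opTrace_eq_tsum`. -/
def opTrace {H : Type*} [NormedAddCommGroup H] [InnerProductSpace ℂ H]
    [CompleteSpace H]
    (a : H →L[ℂ] H) : ℝ≥0∞ :=
  ∑' i, ENNReal.ofReal
    (RCLike.re ⟪(exists_hilbertBasis ℂ H).choose_spec.choose i,
      a ((exists_hilbertBasis ℂ H).choose_spec.choose i)⟫_ℂ)

/-- The operator `a ⊕ b` on the Hilbert space direct sum `H ⊕ H`. -/
def directSum {H : Type*} [NormedAddCommGroup H] [InnerProductSpace ℂ H]
    (a b : H →L[ℂ] H) : WithLp 2 (H × H) →L[ℂ] WithLp 2 (H × H) :=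
  ((WithLp.prodContinuousLinearEquiv 2 ℂ H H).symm : (H × H) →L[ℂ] WithLp 2 (H × H)) ∘L
    (a.prodMap b) ∘L
      ((WithLp.prodContinuousLinearEquiv 2 ℂ H H) : WithLp 2 (H × H) →L[ℂ] (H × H))

theorem directSum_apply {H : Type*} [NormedAddCommGroup H] [InnerProductSpace ℂ H]
    (a b : H →L[ℂ] H) (x y : H) :
    directSum a b (WithLp.toLp 2 (x, y)) = WithLp.toLp 2 (a x, b y) := rfl

theorem parseval_ennreal {H : Type*} [NormedAddCommGroup H] [InnerProductSpace ℂ H]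
    {ι : Type*} (e : HilbertBasis ι ℂ H) (x : H) :
    ∑' i, ENNReal.ofReal (‖⟪e i, x⟫_ℂ‖ ^ 2) = ENNReal.ofReal (‖x‖ ^ 2) := by
  have h2 : HasSum (fun i => ‖⟪e i, x⟫_ℂ‖ ^ 2) (‖x‖ ^ 2) := by
    rw [← Complex.hasSum_ofReal]
    convert e.hasSum_inner_mul_inner x x using 1
    · rfl
    · funext i
      rw [← inner_conj_symm x (e i), RCLike.conj_mul]
      simp
    · rw [inner_self_eq_norm_sq_to_K]
      simp
  rw [← h2.tsum_eq, ENNReal.ofReal_tsum_of_nonneg (fun i => by positivity) h2.summable]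

theorem tsum_diag_star_mul_self {H : Type*} [NormedAddCommGroup H] [InnerProductSpace ℂ H]
    [CompleteSpace H] {ι κ : Type*} (f : HilbertBasis ι ℂ H) (g : HilbertBasis κ ℂ H)
    (s : H →L[ℂ] H) :
    ∑' i, ENNReal.ofReal (RCLike.re ⟪f i, (star s * s) (f i)⟫_ℂ) =
      ∑' j, ENNReal.ofReal (‖(star s) (g j)‖ ^ 2) := by
  have h1 : ∀ x, RCLike.re ⟪x, (star s * s) x⟫_ℂ = ‖s x‖ ^ 2 := by
    intro x
    change RCLike.re ⟪x, (star s) (s x)⟫_ℂ = _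
    rw [ContinuousLinearMap.star_eq_adjoint, ContinuousLinearMap.adjoint_inner_right]
    exact inner_self_eq_norm_sq (𝕜 := ℂ) (s x)
  calc ∑' i, ENNReal.ofReal (RCLike.re ⟪f i, (star s * s) (f i)⟫_ℂ)
      = ∑' i, ∑' j, ENNReal.ofReal (‖⟪g j, s (f i)⟫_ℂ‖ ^ 2) := by
        refine tsum_congr fun i => ?_
        rw [h1, parseval_ennreal g]
    _ = ∑' j, ∑' i, ENNReal.ofReal (‖⟪g j, s (f i)⟫_ℂ‖ ^ 2) := ENNReal.tsum_comm
    _ = ∑' j, ENNReal.ofReal (‖(star s) (g j)‖ ^ 2) := by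
        refine tsum_congr fun j => ?_
        rw [← parseval_ennreal f]
        refine tsum_congr fun i => ?_
        rw [ContinuousLinearMap.star_eq_adjoint, ContinuousLinearMap.adjoint_inner_right,
          norm_inner_symm]

/-- The trace of a positive operator may be computed in any Hilbert basis. -/
theorem opTrace_eq_tsum {H : Type*} [NormedAddCommGroup H] [InnerProductSpace ℂ H]
    [CompleteSpace H] {ι : Type*} (e : HilbertBasis ι ℂ H) (a : H →L[ℂ] H)
    (ha : a.IsPositive) :
    opTrace a = ∑' i, ENNReal.ofReal (RCLike.re ⟪e i, a (e i)⟫_ℂ) := by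
  obtain ⟨s, rfl⟩ : ∃ s : H →L[ℂ] H, a = star s * s :=
    CStarAlgebra.nonneg_iff_eq_star_mul_self.mp
      ((ContinuousLinearMap.nonneg_iff_isPositive a).mpr ha)
  rw [opTrace, tsum_diag_star_mul_self _ e, tsum_diag_star_mul_self e e]

end FiniteSumsOfProjections

end

open scoped ENNReal InnerProductSpace

/-! Let t = 1 + a - b = ∑ pᵢ with a, b positive and compact on G. The polar decomposition of the row
(p₁, …, pₙ) : Gⁿ → G gives a column w = (wᵢ) : G → Gⁿ with wᵢ t wᵢ* = pᵢ, where P = ∑ wᵢ* wᵢ is the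
projection onto the closure of the range of t (`exists_polar`). Then diag(pᵢ) - w w* is a projection
on Gⁿ whose diagonal entries pᵢ - wᵢ wᵢ* = wᵢ (a - b) wᵢ* are compact. A projection on Gⁿ is at most
n times its diagonal, so this one has finite rank d (`exists_defect_vectors`). Hence wᵢ a wᵢ* and wᵢ
b wᵢ* differ by finite-rank operators of total trace d (`exists_compressions`).

Only 1 - P is lost in compressing, and it maps into ker t, which is finite-dimensional because t is
1 plus a compact operator. Finitely many compressions control a positive operator, and finite-rank
operators lie in every nonzero ideal, so a and b generate the same ideal if both are nonzero. If ker
t = 0, then P = 1 and tr a = tr b + d. Taking b = 0 gives necessity in (i); taking a = k₁ ⊕ 0 and b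
= 0 ⊕ k₂ gives (ii).

Conversely, let k have range V of finite dimension and trace n. Then P_V + k is a sum of dim V + n
rank-one operators, n of them zero, of total trace dim V + n. Rotating pairs of vectors makes them
all unit vectors (`exists_unit_vectors`), and 1 - P_V is the last projection. -/

namespace FiniteSumsOfProjections

/-! ### Douglas factorization and domination of positive operators. -/

section Factorization

/-- Douglas factorization: if `‖A x‖ ≤ ‖B x‖` for all `x`, then `A` factors through `B` by an
operator that vanishes on the orthogonal complement of the range of `B`. -/
theorem exists_factor {E F G : Type*} [NormedAddCommGroup E] [InnerProductSpace ℂ E]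
    [NormedAddCommGroup F] [InnerProductSpace ℂ F] [CompleteSpace F]
    [NormedAddCommGroup G] [InnerProductSpace ℂ G] [CompleteSpace G]
    (A : E →L[ℂ] G) (B : E →L[ℂ] F) (h : ∀ x, ‖A x‖ ≤ ‖B x‖) :
    ∃ C : F →L[ℂ] G, (∀ x, C (B x) = A x) ∧ ∀ y, (∀ x, ⟪B x, y⟫_ℂ = 0) → C y = 0 := by
  let M : Submodule ℂ F := (LinearMap.range (B : E →ₗ[ℂ] F)).topologicalClosure
  have : CompleteSpace M :=
    (Submodule.isClosed_topologicalClosure _).completeSpace_coe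
  have hmem : ∀ x, B x ∈ M := fun x => Submodule.le_topologicalClosure _ ⟨x, rfl⟩
  let B' : E →ₗ[ℂ] M := (B : E →ₗ[ℂ] F).codRestrict M hmem
  have hdense : DenseRange B' := by
    rw [DenseRange, Subtype.dense_iff]
    intro y hy
    have : (Subtype.val '' Set.range B') = Set.range B := by
      ext z; simp [B']
    refine (congrArg (y ∈ closure ·) this).mpr ?_
    exact hy
  have hb : ∃ C : ℝ, ∀ x, ‖(A : E →ₗ[ℂ] G) x‖ ≤ C * ‖B' x‖ :=
    ⟨1, fun x => by simpa [B'] using h x⟩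
  -- On the range of `B` the factor sends `B x` to `A x`; it extends by continuity to the closure
  -- `M`, and by zero to `Mᗮ`.
  refine ⟨((A : E →ₗ[ℂ] G).extendOfNorm B') ∘L M.orthogonalProjectionOnto, fun x => ?_,
    fun y hy => ?_⟩
  · have h1 : M.orthogonalProjectionOnto (B x) = B' x :=
      Submodule.orthogonalProjectionOnto_mem_subspace_eq_self (K := M) (B' x)
    rw [ContinuousLinearMap.comp_apply, h1, LinearMap.extendOfNorm_eq hdense hb]
    rfl
  · have hy' : y ∈ Mᗮ := by
      rw [Submodule.orthogonal_closure, Submodule.mem_orthogonal]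
      rintro _ ⟨x, rfl⟩
      exact hy x
    rw [ContinuousLinearMap.comp_apply,
      Submodule.orthogonalProjectionOnto_apply_of_mem_orthogonal hy', map_zero]

variable {H : Type*} [NormedAddCommGroup H] [InnerProductSpace ℂ H] [CompleteSpace H]

theorem exists_sqrt {a : H →L[ℂ] H} (ha : a.IsPositive) :
    ∃ s : H →L[ℂ] H, (∀ x y, ⟪s x, y⟫_ℂ = ⟪x, s y⟫_ℂ) ∧ (∀ x, s (s x) = a x) ∧
      ∀ x, ‖s x‖ ^ 2 = RCLike.re ⟪x, a x⟫_ℂ := by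
  have h0 := (ContinuousLinearMap.nonneg_iff_isPositive a).mpr ha
  have hs : (CFC.sqrt a).IsPositive :=
    (ContinuousLinearMap.nonneg_iff_isPositive _).mp (CFC.sqrt_nonneg a)
  have hss : ∀ x, CFC.sqrt a (CFC.sqrt a x) = a x := fun x =>
    DFunLike.congr_fun (CFC.sqrt_mul_sqrt_self a h0) x
  refine ⟨CFC.sqrt a, hs.inner_left_eq_inner_right, hss, fun x => ?_⟩
  rw [← hss, ← hs.inner_left_eq_inner_right]
  exact (inner_self_eq_norm_sq (𝕜 := ℂ) _).symm

/-- A positive operator dominated by another one is obtained from it by compression. -/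
theorem exists_eq_mul_mul_star {a d : H →L[ℂ] H} (ha : a.IsPositive) (hd : d.IsPositive)
    (h : ∀ x, RCLike.re ⟪x, a x⟫_ℂ ≤ RCLike.re ⟪x, d x⟫_ℂ) :
    ∃ c : H →L[ℂ] H, a = c * d * star c := by
  obtain ⟨r, hr, hrr, hrn⟩ := exists_sqrt ha
  obtain ⟨s, hs, hss, hsn⟩ := exists_sqrt hd
  obtain ⟨c, hc, -⟩ := exists_factor r s fun x => by
    have := h x
    rw [← hrn, ← hsn] at this
    exact le_of_sq_le_sq this (norm_nonneg _)
  refine ⟨c, ContinuousLinearMap.ext fun x => ?_⟩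
  have h1 : s (star c x) = r x := by
    refine ext_inner_left ℂ fun y => ?_
    rw [← hs, ContinuousLinearMap.star_eq_adjoint, ContinuousLinearMap.adjoint_inner_right, hc, hr]
  change a x = c (d (star c x))
  rw [← hss, h1, hc, hrr]

end Factorization

/-! ### Two-sided ideals, finite rank, and compressions. -/

section Ideals

variable {H : Type*} [NormedAddCommGroup H] [InnerProductSpace ℂ H]

/-- The ideal of operators of finite rank. -/
def finiteRank (H : Type*) [NormedAddCommGroup H] [InnerProductSpace ℂ H] :
    TwoSidedIdeal (H →L[ℂ] H) :=
  TwoSidedIdeal.mk' {a | FiniteDimensional ℂ (LinearMap.range (a : H →ₗ[ℂ] H))}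
    (by
      rw [Set.mem_ofPred_eq, ContinuousLinearMap.toLinearMap_zero, LinearMap.range_zero]
      exact Module.Finite.bot ℂ H)
    (fun {x y} hx hy => by
      simp only [Set.mem_ofPred_eq] at hx hy ⊢
      rw [ContinuousLinearMap.toLinearMap_add]
      exact Submodule.finiteDimensional_of_le (LinearMap.range_add_le _ _))
    (fun {x} hx => by
      simp only [Set.mem_ofPred_eq] at hx ⊢
      rw [ContinuousLinearMap.toLinearMap_neg, LinearMap.range_neg]
      exact hx)
    (fun {x y} hy => by
      simp only [Set.mem_ofPred_eq] at hy ⊢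
      rw [ContinuousLinearMap.toLinearMap_mul, Module.End.mul_eq_comp, LinearMap.range_comp]
      infer_instance)
    (fun {x y} hx => by
      simp only [Set.mem_ofPred_eq] at hx ⊢
      exact Submodule.finiteDimensional_of_le (S₂ := LinearMap.range (x : H →ₗ[ℂ] H))
        (LinearMap.range_comp_le_range _ _))

theorem mem_finiteRank {a : H →L[ℂ] H} :
    a ∈ finiteRank H ↔ FiniteDimensional ℂ (LinearMap.range (a : H →ₗ[ℂ] H)) :=
  TwoSidedIdeal.mem_mk' _ _ _ _ _ _ _

theorem mem_finiteRank_of_forall_mem {a : H →L[ℂ] H} (V : Submodule ℂ H) [FiniteDimensional ℂ V]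
    (h : ∀ x, a x ∈ V) : a ∈ finiteRank H := by
  rw [mem_finiteRank]
  refine Submodule.finiteDimensional_of_le (S₂ := V) ?_
  rintro _ ⟨x, rfl⟩
  exact h x

theorem rankOne_mem {I : TwoSidedIdeal (H →L[ℂ] H)} {b : H →L[ℂ] H} (hb : b ∈ I) (hb0 : b ≠ 0)
    (x y : H) : InnerProductSpace.rankOne ℂ x y ∈ I := by
  obtain ⟨z, hz⟩ : ∃ z, b z ≠ 0 := by
    by_contra! h
    exact hb0 (ContinuousLinearMap.ext h)
  have hz' : ⟪b z, b z⟫_ℂ ≠ 0 := inner_self_ne_zero.mpr hz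
  have : InnerProductSpace.rankOne ℂ x y =
      InnerProductSpace.rankOne ℂ x ((⟪b z, b z⟫_ℂ)⁻¹ • b z) * b *
        InnerProductSpace.rankOne ℂ z y := by
    ext u
    have h1 : ⟪(⟪b z, b z⟫_ℂ)⁻¹ • b z, b z⟫_ℂ = 1 := by
      rw [inner_smul_left, map_inv₀, inner_conj_symm, inv_mul_cancel₀ hz']
    simp only [mul_apply_eq_comp, InnerProductSpace.rankOne_apply, map_smul, h1,
      one_smul]
  rw [this]
  exact I.mul_mem_right _ _ (I.mul_mem_left _ _ hb)

/-- Composing with the projection onto its range splits `a` into rank-one pieces, and a nonzero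
ideal contains every rank-one operator. -/
theorem finiteRank_mem {I : TwoSidedIdeal (H →L[ℂ] H)} {b : H →L[ℂ] H} (hb : b ∈ I) (hb0 : b ≠ 0)
    {a : H →L[ℂ] H} (ha : a ∈ finiteRank H) : a ∈ I := by
  rw [mem_finiteRank] at ha
  let V := LinearMap.range (a : H →ₗ[ℂ] H)
  have h1 : a = V.starProjection * a := by
    ext x
    exact (Submodule.starProjection_eq_self_iff.mpr (LinearMap.mem_range_self _ x)).symm
  rw [h1, (stdOrthonormalBasis ℂ V).starProjection_eq_sum_rankOne]
  exact I.mul_mem_right _ _ (sum_mem fun i _ => rankOne_mem hb hb0 _ _)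

variable [CompleteSpace H]

/-- A positive operator `a` lies in a two-sided ideal as soon as the diagonal compressions of `a`
by a finite resolution of the identity do. -/
theorem mem_of_compressions_mem {ι : Type*} [Fintype ι] {I : TwoSidedIdeal (H →L[ℂ] H)}
    {a : H →L[ℂ] H} (ha : a.IsPositive) (c : ι → H →L[ℂ] H) (hc : ∑ i, c i = 1)
    (h : ∀ i, star (c i) * a * c i ∈ I) : a ∈ I := by
  have hpos : ∀ i, (star (c i) * a * c i).IsPositive := fun i => ha.adjoint_conj (c i)
  -- The factor is the Cauchy–Schwarz constant in ‖∑ s (c i x)‖² ≤ card ι · ∑ ‖s (c i x)‖², which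
  -- says a ≤ d.
  let d := Fintype.card ι • ∑ i, star (c i) * a * c i
  have hd : d.IsPositive := by
    rw [← ContinuousLinearMap.nonneg_iff_isPositive]
    exact nsmul_nonneg (Finset.sum_nonneg fun i _ =>
      (ContinuousLinearMap.nonneg_iff_isPositive _).mpr (hpos i)) _
  have hdI : d ∈ I := nsmul_mem (sum_mem fun i _ => h i) _
  obtain ⟨s, -, -, hsn⟩ := exists_sqrt ha
  obtain ⟨e, he⟩ := exists_eq_mul_mul_star ha hd fun x => by
    have h1 : s x = ∑ i, s (c i x) := by
      conv_lhs => rw [← one_apply_eq_self (F := H →L[ℂ] H) x, ← hc]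
      simp
    have h2 : RCLike.re ⟪x, d x⟫_ℂ = Fintype.card ι * ∑ i, ‖s (c i x)‖ ^ 2 := by
      have h3 : ∀ i, ⟪x, (star (c i) * a * c i) x⟫_ℂ = ⟪c i x, a (c i x)⟫_ℂ := fun i =>
        ContinuousLinearMap.adjoint_inner_right (c i) x _
      simp only [d, _root_.smul_apply, _root_.sum_apply, inner_sum,
        hsn, ← h3, ← Nat.cast_smul_eq_nsmul ℂ, inner_smul_right]
      simp [Finset.mul_sum]
    rw [h2, ← hsn, h1]
    calc ‖∑ i, s (c i x)‖ ^ 2 ≤ (∑ i, ‖s (c i x)‖) ^ 2 := by gcongr; exact norm_sum_le _ _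
      _ ≤ _ := by simpa using sq_sum_le_card_mul_sum_sq (s := Finset.univ)
                    (f := fun i => ‖s (c i x)‖)
  rw [he]
  exact I.mul_mem_right _ _ (I.mul_mem_left _ _ hdI)

end Ideals

/-! ### Compact operators. -/

section Compact

/-- A compact operator which is bounded below has finite-dimensional domain. -/
theorem finiteDimensional_of_isCompactOperator {E F : Type*} [NormedAddCommGroup E]
    [NormedSpace ℂ E] [CompleteSpace E] [NormedAddCommGroup F] [NormedSpace ℂ F]
    (T : E →L[ℂ] F) (hT : IsCompactOperator T) (C : ℝ) (h : ∀ x, ‖x‖ ≤ C * ‖T x‖) :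
    FiniteDimensional ℂ E := by
  obtain ⟨K, hK, hKT⟩ := hT.image_closedBall_subset_compact 1 (f := (T : E →ₗ[ℂ] F))
  have hanti : AntilipschitzWith C.toNNReal T :=
    ContinuousLinearMap.antilipschitz_of_bound T fun x =>
      (h x).trans (by gcongr; exact Real.le_coe_toNNReal C)
  have hemb : Topology.IsClosedEmbedding T := hanti.isClosedEmbedding T.uniformContinuous
  refine FiniteDimensional.of_isCompact_closedBall ℂ one_pos (c := (0 : E)) ?_
  refine (hemb.isCompact_preimage hK).of_isClosed_subset Metric.isClosed_closedBall ?_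
  intro x hx
  exact hKT ⟨x, hx, rfl⟩

theorem isCompactOperator_sum {E F ι : Type*} [NormedAddCommGroup E]
    [NormedSpace ℂ E] [NormedAddCommGroup F] [NormedSpace ℂ F] (s : Finset ι)
    (T : ι → E →L[ℂ] F) (hT : ∀ i, IsCompactOperator (T i)) :
    IsCompactOperator (∑ i ∈ s, T i : E →L[ℂ] F) := by
  classical
  induction s using Finset.induction_on with
  | empty => simpa using isCompactOperator_zero
  | insert i s hi ih =>
    rw [Finset.sum_insert hi]
    exact (hT i).add ih

end Compact

/-! ### The row of projections, its polar part and its defect. -/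

section Dilation

variable {G : Type*} [NormedAddCommGroup G] [InnerProductSpace ℂ G] [CompleteSpace G]

/-- The polar decomposition of the row operator `(p₁, …, pₙ)`, where the `pᵢ` are projections with
sum `t`. -/
theorem exists_polar {ι : Type*} [Fintype ι] (p : ι → G →L[ℂ] G) (hp : ∀ i, IsStarProjection (p i))
    (t : G →L[ℂ] G) (ht : t = ∑ i, p i) :
    ∃ w : ι → G →L[ℂ] G, (∀ i, p i * w i = w i) ∧ (∀ i, w i * t * star (w i) = p i) ∧
      (∀ i, w i * ∑ j, star (w j) * w j = w i) ∧ t * (1 - ∑ j, star (w j) * w j) = 0 := by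
  have hpp : ∀ i, (p i).IsPositive := fun i => ContinuousLinearMap.IsPositive.of_isStarProjection (hp i)
  have htp : t.IsPositive := by
    rw [ht, ← ContinuousLinearMap.nonneg_iff_isPositive]
    exact Finset.sum_nonneg fun i _ =>
      (ContinuousLinearMap.nonneg_iff_isPositive _).mpr (hpp i)
  have hpi : ∀ i x, p i (p i x) = p i x := fun i x =>
    DFunLike.congr_fun (hp i).isIdempotentElem x
  obtain ⟨s, hs, hss, hsn⟩ := exists_sqrt htp
  -- ‖p i x‖² = ⟪x, p i x⟫ is one term of ⟪x, t x⟫ = ‖s x‖².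
  have hle : ∀ i x, ‖p i x‖ ≤ ‖s x‖ := by
    intro i x
    refine le_of_sq_le_sq ?_ (norm_nonneg _)
    have h1 : ∀ j, ‖p j x‖ ^ 2 = RCLike.re ⟪x, p j x⟫_ℂ := by
      intro j
      rw [← hpi j x, ← (hpp j).inner_left_eq_inner_right, hpi]
      exact (inner_self_eq_norm_sq (𝕜 := ℂ) _).symm
    rw [hsn, ht, _root_.sum_apply, inner_sum, map_sum]
    simp_rw [← h1]
    exact Finset.single_le_sum (f := fun j => ‖p j x‖ ^ 2) (fun _ _ => by positivity)
      (Finset.mem_univ i)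
  choose w₀ hw₀ hw₀z using fun i => exists_factor (p i) s (hle i)
  let w : ι → G →L[ℂ] G := fun i => p i * w₀ i
  have hws : ∀ i x, w i (s x) = p i x := fun i x => by
    change p i (w₀ i (s x)) = _
    rw [hw₀, hpi]
  have hwz : ∀ i y, s y = 0 → w i y = 0 := fun i y hy => by
    change p i (w₀ i y) = 0
    rw [hw₀z i y fun x => by rw [hs, hy, inner_zero_right], map_zero]
  have hswa : ∀ i x, s (star (w i) x) = p i x := fun i x => by
    refine ext_inner_left ℂ fun y => ?_
    rw [← hs, ContinuousLinearMap.star_eq_adjoint, ContinuousLinearMap.adjoint_inner_right, hws,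
      (hpp i).inner_left_eq_inner_right]
  set P : G →L[ℂ] G := ∑ j, star (w j) * w j with hP
  have hPapp : ∀ x, P x = ∑ j, star (w j) (w j x) := fun x => by
    simp [hP, _root_.sum_apply]
  have hPin : ∀ x y, ⟪P x, y⟫_ℂ = ∑ j, ⟪w j x, w j y⟫_ℂ := fun x y => by
    rw [hPapp, sum_inner]
    refine Finset.sum_congr rfl fun j _ => ?_
    rw [ContinuousLinearMap.star_eq_adjoint, ContinuousLinearMap.adjoint_inner_left]
  have hPin' : ∀ x y, ⟪x, P y⟫_ℂ = ∑ j, ⟪w j x, w j y⟫_ℂ := fun x y => by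
    rw [hPapp, inner_sum]
    refine Finset.sum_congr rfl fun j _ => ?_
    rw [ContinuousLinearMap.star_eq_adjoint, ContinuousLinearMap.adjoint_inner_right]
  -- `P (s x) - s x` lies in ker s because ∑ p j = t. It is also orthogonal to ker s, since all `w
  -- j` vanish there and `s` is self-adjoint.
  have hPs : ∀ x, P (s x) = s x := by
    intro x
    have hz : s (P (s x) - s x) = 0 := by
      rw [map_sub, hPapp, map_sum, hss, ht, _root_.sum_apply, sub_eq_zero]
      refine Finset.sum_congr rfl fun j _ => ?_
      rw [hswa, hws, hpi]
    rw [← sub_eq_zero, ← inner_self_eq_zero (𝕜 := ℂ)]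
    nth_rw 1 [inner_sub_left]
    rw [hPin, hs, hz, inner_zero_right, sub_zero]
    exact Finset.sum_eq_zero fun j _ => by rw [hwz j _ hz, inner_zero_right]
  have hsP : ∀ x, s (P x) = s x := fun x => by
    refine ext_inner_left ℂ fun y => ?_
    rw [← hs, hPin', ← hPin, hPs, hs]
  refine ⟨w, fun i => ?_, fun i => ?_, fun i => ?_, ?_⟩
  · rw [← mul_assoc, (hp i).isIdempotentElem]
  · ext x
    change w i (t (star (w i) x)) = _
    rw [← hss, hws, hswa, hpi]
  · ext x
    change w i (P x) = w i x
    rw [← sub_eq_zero, ← map_sub]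
    exact hwz i _ (by rw [map_sub, hsP, sub_self])
  · ext x
    change t (x - P x) = 0
    rw [← hss, map_sub s, hsP, sub_self, map_zero]

/-- The Hilbert space direct sum of `n` copies of `G`. -/
abbrev HilbertPower (G : Type*) (n : ℕ) : Type _ := PiLp 2 fun _ : Fin n => G

/-- The compressions `pᵢ - wᵢ wᵢ*` of the defect projection of a row of projections: if they are
compact, they are simultaneously given by finitely many unit vectors of `Gⁿ`. -/
theorem exists_defect_vectors {n : ℕ} (p w : Fin n → G →L[ℂ] G)
    (hp : ∀ i, IsStarProjection (p i)) (hpw : ∀ i, p i * w i = w i)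
    (hwP : ∀ i, w i * ∑ j, star (w j) * w j = w i)
    (hq : ∀ i, IsCompactOperator (p i - w i * star (w i) : G →L[ℂ] G)) :
    ∃ (d : ℕ) (f : Fin d → Fin n → G), (∀ l, ∑ i, ‖f l i‖ ^ 2 = 1) ∧
      ∀ i, p i - w i * star (w i) = ∑ l, InnerProductSpace.rankOne ℂ (f l i) (f l i) := by
  have hpp : ∀ i, (p i).IsPositive := fun i => ContinuousLinearMap.IsPositive.of_isStarProjection (hp i)
  have hpi : ∀ i x, p i (p i x) = p i x := fun i x =>
    DFunLike.congr_fun (hp i).isIdempotentElem x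
  have hpw' : ∀ i x, p i (w i x) = w i x := fun i x => DFunLike.congr_fun (hpw i) x
  let e : HilbertPower G n ≃L[ℂ] (Fin n → G) := PiLp.continuousLinearEquiv 2 ℂ (fun _ : Fin n => G)
  let D : Fin n → G →L[ℂ] HilbertPower G n := fun i => (e.symm : (Fin n → G) →L[ℂ] HilbertPower G n) ∘L
    ContinuousLinearMap.single ℂ (fun _ : Fin n => G) i
  have hD : ∀ i y j, (D i y) j = if j = i then y else 0 := fun i y j => by
    change (Pi.single i y : Fin n → G) j = _
    rw [Pi.single_apply]
  have hDin : ∀ i (x : HilbertPower G n) y, ⟪x, D i y⟫_ℂ = ⟪x i, y⟫_ℂ := fun i x y => by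
    rw [PiLp.inner_apply, Finset.sum_eq_single i]
    · rw [hD, if_pos rfl]
    · intro j _ hj
      rw [hD, if_neg hj, inner_zero_right]
    · simp
  let pr : Fin n → (HilbertPower G n) →L[ℂ] G := fun i => PiLp.proj 2 (fun _ : Fin n => G) i
  let W : HilbertPower G n →L[ℂ] G := ∑ i, star (w i) ∘L pr i
  have hW : ∀ x : HilbertPower G n, W x = ∑ i, star (w i) (x i) := fun x => by
    simp only [W, _root_.sum_apply]
    rfl
  -- The range of the projection diag(pᵢ) - w w*; here `W` is w*.
  let M : Submodule ℂ (HilbertPower G n) := LinearMap.ker (W : HilbertPower G n →ₗ[ℂ] G) ⊓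
    ⨅ i, LinearMap.ker ((p i ∘L pr i - pr i : HilbertPower G n →L[ℂ] G) : HilbertPower G n →ₗ[ℂ] G)
  have hM : ∀ x : HilbertPower G n, x ∈ M ↔ W x = 0 ∧ ∀ i, p i (x i) = x i := fun x => by
    simp only [M, Submodule.mem_inf, Submodule.mem_iInf, LinearMap.mem_ker]
    refine and_congr Iff.rfl (forall_congr' fun i => ?_)
    exact sub_eq_zero (a := p i (x i)) (b := x i)
  have hMc : IsClosed (M : Set (HilbertPower G n)) := by
    have : (M : Set (HilbertPower G n)) = {x | W x = 0} ∩ ⋂ i, {x : HilbertPower G n | p i (pr i x) = pr i x} := by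
      ext x
      simp only [SetLike.mem_coe, hM, Set.mem_inter_iff, Set.mem_iInter, Set.mem_ofPred_eq]
      rfl
    rw [this]
    refine (isClosed_eq W.continuous continuous_const).inter (isClosed_iInter fun i => ?_)
    exact isClosed_eq ((p i).continuous.comp (pr i).continuous) (pr i).continuous
  have : CompleteSpace M := hMc.completeSpace_coe
  -- The i-th column of diag(pᵢ) - w w*, applied to `y`; it will be the projection of `D i y` onto
  -- `M`.
  let z : Fin n → G → (HilbertPower G n) := fun i y =>
    WithLp.toLp 2 fun j => (if j = i then p i y else 0) - w j (star (w i) y)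
  have hz : ∀ i y j, (z i y) j = (if j = i then p i y else 0) - w j (star (w i) y) :=
    fun i y j => rfl
  have hwsp : ∀ i y, star (w i) (p i y) = star (w i) y := fun i y => by
    refine ext_inner_left ℂ fun u => ?_
    rw [ContinuousLinearMap.star_eq_adjoint, ContinuousLinearMap.adjoint_inner_right,
      ContinuousLinearMap.adjoint_inner_right, ← (hpp i).inner_left_eq_inner_right, hpw']
  have hPw : ∀ i y, ∑ j, star (w j) (w j (star (w i) y)) = star (w i) y := fun i y => by
    have := congrArg star (hwP i)
    rw [star_mul, star_sum] at this
    simp only [star_mul, star_star] at this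
    simpa [_root_.sum_apply] using DFunLike.congr_fun this y
  have hzM : ∀ i y, z i y ∈ M := fun i y => by
    rw [hM]
    constructor
    · simp only [hW, hz, map_sub, Finset.sum_sub_distrib, hPw]
      rw [Finset.sum_eq_single i (fun j _ hj => by rw [if_neg hj, map_zero]) (by simp), if_pos rfl,
        hwsp, sub_self]
    · intro j
      rw [hz, map_sub, hpw']
      split_ifs with h
      · rw [h, hpi]
      · rw [map_zero]
  have hzort : ∀ i y, D i y - z i y ∈ Mᗮ := fun i y => by
    rw [Submodule.mem_orthogonal]
    intro x hx
    rw [hM, hW] at hx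
    have h1 : ⟪x, z i y⟫_ℂ = ⟪x i, p i y⟫_ℂ - ⟪∑ j, star (w j) (x j), star (w i) y⟫_ℂ := by
      simp only [PiLp.inner_apply, hz, inner_sub_right, Finset.sum_sub_distrib, sum_inner]
      congr 1
      · rw [Finset.sum_eq_single i (fun j _ hj => by rw [if_neg hj, inner_zero_right]) (by simp),
          if_pos rfl]
      · refine Finset.sum_congr rfl fun j _ => ?_
        nth_rw 2 [ContinuousLinearMap.star_eq_adjoint]
        rw [ContinuousLinearMap.adjoint_inner_left]
    rw [inner_sub_right, hDin, h1, hx.1, inner_zero_left, sub_zero,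
      ← (hpp i).inner_left_eq_inner_right, hx.2, sub_self]
  have hQD : ∀ i y, M.starProjection (D i y) = z i y := fun i y =>
    Submodule.eq_starProjection_of_mem_orthogonal (hzM i y) (hzort i y)
  have hzin : ∀ i y, ‖z i y‖ ^ 2 = RCLike.re ⟪y, (p i - w i * star (w i)) y⟫_ℂ := fun i y => by
    have h1 : ⟪z i y, z i y⟫_ℂ = ⟪z i y, D i y⟫_ℂ := by
      have := Submodule.inner_right_of_mem_orthogonal (hzM i y) (hzort i y)
      rw [inner_sub_right, sub_eq_zero] at this
      exact this.symm
    rw [← inner_self_eq_norm_sq (𝕜 := ℂ), h1, hDin, hz, if_pos rfl, inner_re_symm]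
    rfl
  -- The diagonal of the projection onto `M`. For x in `M`, x = ∑ z i (x i), so Cauchy–Schwarz gives
  -- ‖x‖² ≤ n ⟪x, S x⟫, and the compact `S` is bounded below on `M`.
  let S : HilbertPower G n →L[ℂ] HilbertPower G n := ∑ i, D i ∘L (p i - w i * star (w i)) ∘L pr i
  have hS : IsCompactOperator S := isCompactOperator_sum _ _ fun i =>
    ((hq i).comp_clm (pr i)).clm_comp (D i)
  have hMfin : FiniteDimensional ℂ M := by
    refine finiteDimensional_of_isCompactOperator (S ∘L M.subtypeL) (hS.comp_clm _) n ?_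
    rintro ⟨x, hx⟩
    change ‖x‖ ≤ n * ‖S x‖
    have h1 : x = ∑ i, z i (x i) := by
      have : x = ∑ i, D i (x i) := by
        ext j
        rw [WithLp.ofLp_sum, Finset.sum_apply]
        simp [hD]
      conv_lhs => rw [← Submodule.starProjection_eq_self_iff.mpr hx, this]
      simp_rw [map_sum, hQD]
    have h2 : ‖x‖ ^ 2 ≤ n * ∑ i, ‖z i (x i)‖ ^ 2 := by
      conv_lhs => rw [h1]
      calc ‖∑ i, z i (x i)‖ ^ 2 ≤ (∑ i, ‖z i (x i)‖) ^ 2 := by gcongr; exact norm_sum_le _ _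
        _ ≤ _ := by simpa using sq_sum_le_card_mul_sum_sq (s := Finset.univ)
                      (f := fun i => ‖z i (x i)‖)
    have h3 : ∑ i, ‖z i (x i)‖ ^ 2 = RCLike.re ⟪x, S x⟫_ℂ := by
      simp only [hzin, S, _root_.sum_apply, inner_sum, map_sum]
      refine Finset.sum_congr rfl fun i _ => ?_
      exact congrArg RCLike.re (hDin i x _).symm
    rw [h3] at h2
    have h4 : RCLike.re ⟪x, S x⟫_ℂ ≤ ‖x‖ * ‖S x‖ := re_inner_le_norm _ _
    rcases (norm_nonneg x).eq_or_lt with h0 | h0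
    · rw [← h0]; positivity
    · refine le_of_mul_le_mul_left ?_ h0
      calc ‖x‖ * ‖x‖ = ‖x‖ ^ 2 := (sq _).symm
        _ ≤ n * (‖x‖ * ‖S x‖) := h2.trans (by gcongr)
        _ = ‖x‖ * (n * ‖S x‖) := by ring
  let b := stdOrthonormalBasis ℂ M
  refine ⟨Module.finrank ℂ M, fun l i => (b l : HilbertPower G n) i, fun l => ?_, fun i => ?_⟩
  · rw [← PiLp.norm_sq_eq_of_L2 (fun _ : Fin n => G) (b l : HilbertPower G n)]
    have := b.orthonormal.1 l
    rw [Submodule.norm_coe, this, one_pow]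
  · ext y
    have h1 : (p i - w i * star (w i)) y = (M.starProjection (D i y)) i := by
      rw [hQD, hz, if_pos rfl]
      rfl
    rw [h1, b.starProjection_eq_sum_rankOne]
    simp [hDin, _root_.sum_apply, WithLp.ofLp_sum]

end Dilation

/-! ### Trace identities in [0, ∞]. -/

section Trace

variable {H : Type*} [NormedAddCommGroup H] [InnerProductSpace ℂ H] [CompleteSpace H]
  {F : Type*} [NormedAddCommGroup F] [InnerProductSpace ℂ F]

/-- The hypothesis expresses a = s* s without an adjoint, and already makes `a` positive. -/
theorem opTrace_eq_tsum_norm_sq {ι : Type*} (e : HilbertBasis ι ℂ H) {a : H →L[ℂ] H}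
    (s : H →L[ℂ] F) (hs : ∀ x, ⟪x, a x⟫_ℂ = ⟪s x, s x⟫_ℂ) :
    opTrace a = ∑' i, ENNReal.ofReal (‖s (e i)‖ ^ 2) := by
  have h : ∀ x, RCLike.re ⟪x, a x⟫_ℂ = ‖s x‖ ^ 2 := fun x => by
    rw [hs]; exact inner_self_eq_norm_sq (𝕜 := ℂ) _
  have ha : a.IsPositive := by
    rw [ContinuousLinearMap.isPositive_iff_complex]
    intro x
    have h1 : ⟪a x, x⟫_ℂ = ((‖s x‖ ^ 2 : ℝ) : ℂ) := by
      rw [← inner_conj_symm, hs, inner_self_eq_norm_sq_to_K]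
      simp
    rw [h1]
    exact ⟨rfl, sq_nonneg ‖s x‖⟩
  simp_rw [opTrace_eq_tsum e a ha, h]

variable [CompleteSpace F]

/-- By Parseval both sides are the double sum of |⟪g j, s (f i)⟫|². -/
theorem tsum_norm_sq_adjoint {ι κ : Type*} (f : HilbertBasis ι ℂ H) (g : HilbertBasis κ ℂ F)
    (s : H →L[ℂ] F) :
    ∑' i, ENNReal.ofReal (‖s (f i)‖ ^ 2) =
      ∑' j, ENNReal.ofReal (‖(ContinuousLinearMap.adjoint s) (g j)‖ ^ 2) := by
  simp_rw [← parseval_ennreal g (s _), ← parseval_ennreal f (ContinuousLinearMap.adjoint s _)]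
  rw [ENNReal.tsum_comm]
  refine tsum_congr fun j => tsum_congr fun i => ?_
  rw [ContinuousLinearMap.adjoint_inner_right, norm_inner_symm]

theorem opTrace_eq_tsum_norm_sq_adjoint {κ : Type*} (g : HilbertBasis κ ℂ F) {a : H →L[ℂ] H}
    (s : H →L[ℂ] F) (hs : ∀ x, ⟪x, a x⟫_ℂ = ⟪s x, s x⟫_ℂ) :
    opTrace a = ∑' j, ENNReal.ofReal (‖(ContinuousLinearMap.adjoint s) (g j)‖ ^ 2) := by
  obtain ⟨_, e, -⟩ := exists_hilbertBasis ℂ H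
  rw [opTrace_eq_tsum_norm_sq e s hs, tsum_norm_sq_adjoint e g]

theorem opTrace_add {a b : H →L[ℂ] H} (ha : a.IsPositive) (hb : b.IsPositive) :
    opTrace (a + b) = opTrace a + opTrace b := by
  obtain ⟨_, e, -⟩ := exists_hilbertBasis ℂ H
  rw [opTrace_eq_tsum e _ ha, opTrace_eq_tsum e _ hb, opTrace_eq_tsum e _ (ha.add hb),
    ← ENNReal.tsum_add]
  refine tsum_congr fun i => ?_
  rw [← ENNReal.ofReal_add (ha.re_inner_nonneg_right _) (hb.re_inner_nonneg_right _),
    _root_.add_apply, inner_add_right, map_add]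

theorem isPositive_sum_rankOne {ι : Type*} [Fintype ι] (f : ι → H) :
    (∑ l, InnerProductSpace.rankOne ℂ (f l) (f l)).IsPositive := by
  rw [← ContinuousLinearMap.nonneg_iff_isPositive]
  exact Finset.sum_nonneg fun i _ => (ContinuousLinearMap.nonneg_iff_isPositive _).mpr
    (InnerProductSpace.isPositive_rankOne_self _)

theorem opTrace_sum_rankOne {ι : Type*} [Fintype ι] (f : ι → H) :
    opTrace (∑ l, InnerProductSpace.rankOne ℂ (f l) (f l)) =
      ENNReal.ofReal (∑ l, ‖f l‖ ^ 2) := by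
  obtain ⟨_, e, -⟩ := exists_hilbertBasis ℂ H
  rw [opTrace_eq_tsum e _ (isPositive_sum_rankOne f),
    ENNReal.ofReal_sum_of_nonneg (fun _ _ => by positivity)]
  simp_rw [← parseval_ennreal e]
  rw [← Summable.tsum_finsetSum fun _ _ => ENNReal.summable]
  refine tsum_congr fun i => ?_
  rw [← ENNReal.ofReal_sum_of_nonneg (fun _ _ => by positivity)]
  congr 1
  rw [_root_.sum_apply, inner_sum, map_sum]
  refine Finset.sum_congr rfl fun l _ => ?_
  rw [InnerProductSpace.rankOne_apply, inner_smul_right, inner_mul_symm_re_eq_norm, norm_mul,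
    norm_inner_symm (f l), sq]

/-- With r the square root of `a`, the i-th trace is ∑ⱼ ‖w i (r (e j))‖², and ∑ᵢ ‖w i y‖² = ‖y‖². -/
theorem opTrace_eq_sum_compressions {ι : Type*} [Fintype ι] {a : H →L[ℂ] H} (ha : a.IsPositive)
    (w : ι → H →L[ℂ] H) (hw : ∑ i, star (w i) * w i = 1) :
    opTrace a = ∑ i, opTrace (w i * a * star (w i)) := by
  obtain ⟨_, e, -⟩ := exists_hilbertBasis ℂ H
  obtain ⟨r, hr, hrr, -⟩ := exists_sqrt ha
  have hra : ContinuousLinearMap.adjoint r = r :=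
    (ContinuousLinearMap.eq_adjoint_iff r r).mpr hr |>.symm
  have h1 : ∀ i, opTrace (w i * a * star (w i)) = ∑' j, ENNReal.ofReal (‖w i (r (e j))‖ ^ 2) := by
    intro i
    rw [opTrace_eq_tsum_norm_sq_adjoint e (r * star (w i)) fun x => ?_]
    · rw [← ContinuousLinearMap.star_eq_adjoint, star_mul, star_star,
        ContinuousLinearMap.star_eq_adjoint r, hra]
      rfl
    · change ⟪x, w i (a (star (w i) x))⟫_ℂ = ⟪r (star (w i) x), r (star (w i) x)⟫_ℂ
      rw [hr, hrr, ← ContinuousLinearMap.adjoint_inner_left]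
      rfl
  simp_rw [h1]
  rw [opTrace_eq_tsum_norm_sq e r fun x => by rw [hr, hrr],
    ← Summable.tsum_finsetSum fun _ _ => ENNReal.summable]
  refine tsum_congr fun j => ?_
  rw [← ENNReal.ofReal_sum_of_nonneg (fun _ _ => by positivity)]
  congr 1
  have h2 : ∀ y, ⟪y, y⟫_ℂ = ∑ i, ⟪w i y, w i y⟫_ℂ := fun y => by
    have h3 : y = ∑ i, (star (w i) * w i) y := by
      rw [← _root_.sum_apply, hw, one_apply_eq_self]
    have h4 : ∀ i, ⟪w i y, w i y⟫_ℂ = ⟪(star (w i) * w i) y, y⟫_ℂ := fun i =>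
      (ContinuousLinearMap.adjoint_inner_left (w i) y (w i y)).symm
    simp_rw [h4]
    rw [← sum_inner, ← h3]
  have h3 := congrArg RCLike.re (h2 (r (e j)))
  rw [map_sum] at h3
  simpa only [inner_self_eq_norm_sq (𝕜 := ℂ)] using h3

/-- The trace is invariant under conjugation by an isometry. -/
theorem opTrace_conj {k : H →L[ℂ] H} (hk : k.IsPositive) (u : H →L[ℂ] F) (hu : ∀ x, ‖u x‖ = ‖x‖) :
    opTrace (u ∘L k ∘L ContinuousLinearMap.adjoint u) = opTrace k := by
  obtain ⟨_, e, -⟩ := exists_hilbertBasis ℂ H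
  obtain ⟨r, hr, hrr, -⟩ := exists_sqrt hk
  have hra : ContinuousLinearMap.adjoint r = r :=
    (ContinuousLinearMap.eq_adjoint_iff r r).mpr hr |>.symm
  rw [opTrace_eq_tsum_norm_sq_adjoint e (r ∘L ContinuousLinearMap.adjoint u) fun x => ?_,
    opTrace_eq_tsum_norm_sq e r fun x => by rw [hr, hrr]]
  · rw [ContinuousLinearMap.adjoint_comp, ContinuousLinearMap.adjoint_adjoint, hra]
    simp_rw [ContinuousLinearMap.comp_apply, hu]
  · change ⟪x, u (k (ContinuousLinearMap.adjoint u x))⟫_ℂ =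
      ⟪r (ContinuousLinearMap.adjoint u x), r (ContinuousLinearMap.adjoint u x)⟫_ℂ
    rw [hr, hrr, ← ContinuousLinearMap.adjoint_inner_left]

end Trace

/-! ### Consequences of being a finite sum of projections. -/

section Necessity

variable {G : Type*} [NormedAddCommGroup G] [InnerProductSpace ℂ G]

theorem eq_zero_of_add_apply_eq_zero {a : G →L[ℂ] G} (ha : a.IsPositive) {x : G}
    (hx : x + a x = 0) : x = 0 := by
  have h1 : ⟪x, x⟫_ℂ + ⟪x, a x⟫_ℂ = 0 := by rw [← inner_add_right, hx, inner_zero_right]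
  have h2 := congrArg RCLike.re h1
  rw [map_add, inner_self_eq_norm_sq (𝕜 := ℂ), map_zero] at h2
  have h3 := ha.re_inner_nonneg_right x
  exact norm_eq_zero.mp (sq_eq_zero_iff.mp (by linarith [sq_nonneg ‖x‖]))

theorem sum_rankOne_mem_finiteRank {ι : Type*} [Fintype ι] (f g : ι → G) :
    ∑ l, InnerProductSpace.rankOne ℂ (f l) (g l) ∈ finiteRank G :=
  sum_mem fun l _ => mem_finiteRank_of_forall_mem (Submodule.span ℂ {f l}) fun _ =>
    Submodule.smul_mem _ _ (Submodule.mem_span_singleton_self _)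

variable [CompleteSpace G]

theorem star_mul_self_conj_mem {I : TwoSidedIdeal (G →L[ℂ] G)} {a w : G →L[ℂ] G}
    (h : w * a * star w ∈ I) : star (star w * w) * a * (star w * w) ∈ I := by
  have h1 : star (star w * w) * a * (star w * w) = star w * (w * a * star w) * w := by
    rw [star_mul, star_star]
    simp only [mul_assoc]
  rw [h1]
  exact I.mul_mem_right _ _ (I.mul_mem_left _ _ h)

/-- The operators wᵢ* wᵢ and 1 - ∑ wᵢ* wᵢ form a resolution of the identity, so
`mem_of_compressions_mem` applies. -/
theorem mem_of_row_compressions_mem {ι : Type*} [Fintype ι] {I : TwoSidedIdeal (G →L[ℂ] G)}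
    {a : G →L[ℂ] G} (ha : a.IsPositive) (w : ι → G →L[ℂ] G)
    (h1 : 1 - ∑ i, star (w i) * w i ∈ I) (h : ∀ i, w i * a * star (w i) ∈ I) : a ∈ I := by
  refine mem_of_compressions_mem ha
    (fun i : Option ι => i.elim (1 - ∑ i, star (w i) * w i) fun i => star (w i) * w i) ?_ ?_
  · rw [Fintype.sum_option]
    simp
  · rintro (_ | i)
    · exact I.mul_mem_left _ _ h1
    · exact star_mul_self_conj_mem (h i)

/-- If `1 + a - b` is a finite sum of projections with `a`, `b` compact, then there is a finite
family of operators whose compressions of `a` and `b` differ only by operators of finite rank of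
integral total trace. -/
theorem exists_compressions {a b : G →L[ℂ] G} (hca : IsCompactOperator a)
    (hcb : IsCompactOperator b) (h : IsFiniteSumOfProjections (1 + a - b)) :
    ∃ (n d : ℕ) (w : Fin n → G →L[ℂ] G) (f : Fin d → Fin n → G),
      (∀ l, ∑ i, ‖f l i‖ ^ 2 = 1) ∧
      (∀ i, w i * a * star (w i) =
        ∑ l, InnerProductSpace.rankOne ℂ (f l i) (f l i) + w i * b * star (w i)) ∧
      (1 - ∑ i, star (w i) * w i ∈ finiteRank G) ∧
      (1 + a - b) * (1 - ∑ i, star (w i) * w i) = 0 := by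
  obtain ⟨n, p, hp, hsum⟩ := h
  obtain ⟨w, hpw, hwt, hwP, htP⟩ := exists_polar p hp _ hsum
  have hq : ∀ i, p i - w i * star (w i) = w i * (a - b) * star (w i) := fun i => by
    rw [← hwt i]
    noncomm_ring
  obtain ⟨d, f, hf, hqf⟩ := exists_defect_vectors p w hp hpw hwP fun i => by
    rw [hq]
    exact ((hca.sub hcb).comp_clm (star (w i))).clm_comp (w i)
  refine ⟨n, d, w, f, hf, fun i => ?_, ?_, htP⟩
  · rw [← hqf, hq]
    noncomm_ring
  -- On ker t one has x = (b - a) x, so a compact operator acts there as the identity.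
  · let t : G →L[ℂ] G := 1 + a - b
    let V : Submodule ℂ G := LinearMap.ker (t : G →ₗ[ℂ] G)
    have : CompleteSpace V := t.isClosed_ker.completeSpace_coe
    have : FiniteDimensional ℂ V := by
      refine finiteDimensional_of_isCompactOperator ((b - a) ∘L V.subtypeL)
        ((hcb.sub hca).comp_clm _) 1 ?_
      rintro ⟨x, hx⟩
      have h1 : x + a x - b x = 0 := hx
      have h2 : x = b x - a x := by rw [← sub_eq_zero, ← h1]; abel
      rw [one_mul]
      exact (congrArg norm h2).le
    exact mem_finiteRank_of_forall_mem V fun x => DFunLike.congr_fun htP x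

theorem mem_finiteRank_of_isFiniteSumOfProjections {a : G →L[ℂ] G} (ha : a.IsPositive)
    (hca : IsCompactOperator a) (h : IsFiniteSumOfProjections (1 + a)) : a ∈ finiteRank G := by
  obtain ⟨n, d, w, f, -, hw, h1, -⟩ :=
    exists_compressions hca (isCompactOperator_zero (M₂ := G)) (b := 0) (by rwa [sub_zero])
  refine mem_of_row_compressions_mem ha w h1 fun i => ?_
  rw [hw, mul_zero, zero_mul, add_zero]
  exact sum_rankOne_mem_finiteRank _ _

theorem mem_span_of_isFiniteSumOfProjections {a b : G →L[ℂ] G} (ha : a.IsPositive)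
    (hb : b.IsPositive) (hca : IsCompactOperator a) (hcb : IsCompactOperator b) (ha0 : a ≠ 0)
    (hb0 : b ≠ 0) (h : IsFiniteSumOfProjections (1 + a - b)) :
    a ∈ TwoSidedIdeal.span {b} ∧ b ∈ TwoSidedIdeal.span {a} := by
  obtain ⟨n, d, w, f, -, hw, h1, -⟩ := exists_compressions hca hcb h
  have haI : a ∈ TwoSidedIdeal.span {a} := TwoSidedIdeal.subset_span rfl
  have hbI : b ∈ TwoSidedIdeal.span {b} := TwoSidedIdeal.subset_span rfl
  constructor
  · refine mem_of_row_compressions_mem ha w (finiteRank_mem hbI hb0 h1) fun i => ?_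
    rw [hw]
    exact add_mem (finiteRank_mem hbI hb0 (sum_rankOne_mem_finiteRank _ _))
      (TwoSidedIdeal.mul_mem_right _ _ _ (TwoSidedIdeal.mul_mem_left _ _ _ hbI))
  · refine mem_of_row_compressions_mem hb w (finiteRank_mem haI ha0 h1) fun i => ?_
    rw [eq_sub_of_add_eq' (hw i).symm]
    exact sub_mem (TwoSidedIdeal.mul_mem_right _ _ _ (TwoSidedIdeal.mul_mem_left _ _ _ haI))
      (finiteRank_mem haI ha0 (sum_rankOne_mem_finiteRank _ _))

/-- Injectivity of 1 + a - b forces ∑ wᵢ* wᵢ = 1, so both traces are sums over compressions; `d`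
counts the unit defect vectors. -/
theorem exists_opTrace_eq_add {a b : G →L[ℂ] G} (ha : a.IsPositive)
    (hb : b.IsPositive) (hca : IsCompactOperator a) (hcb : IsCompactOperator b)
    (h : IsFiniteSumOfProjections (1 + a - b)) (hker : ∀ x, x + a x - b x = 0 → x = 0) :
    ∃ d : ℕ, opTrace a = opTrace b + d := by
  obtain ⟨n, d, w, f, hf, hw, -, h2⟩ := exists_compressions hca hcb h
  have hP : ∑ i, star (w i) * w i = 1 := by
    rw [eq_comm, ← sub_eq_zero]
    exact ContinuousLinearMap.ext fun x => hker _ (DFunLike.congr_fun h2 x)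
  refine ⟨d, ?_⟩
  have h3 : ∀ i, opTrace (w i * a * star (w i)) =
      ENNReal.ofReal (∑ l, ‖f l i‖ ^ 2) + opTrace (w i * b * star (w i)) := fun i => by
    have hbi : (w i * b * star (w i)).IsPositive := hb.conj_adjoint (w i)
    rw [hw, opTrace_add (isPositive_sum_rankOne _) hbi, opTrace_sum_rankOne]
  rw [opTrace_eq_sum_compressions ha w hP, opTrace_eq_sum_compressions hb w hP, add_comm]
  simp_rw [h3]
  rw [Finset.sum_add_distrib, ← ENNReal.ofReal_sum_of_nonneg (fun _ _ => by positivity),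
    Finset.sum_comm]
  simp [hf]

end Necessity

/-! ### Building projections from a finite-rank operator of integral trace. -/

section Sufficiency

variable {H : Type*} [NormedAddCommGroup H] [InnerProductSpace ℂ H]

/-- A rotation of two vectors making the first one a unit vector, which preserves the sum of the
associated operators of rank one. -/
theorem exists_rotation (x y : H) (hx : ‖x‖ ^ 2 ≤ 1) (hy : 1 ≤ ‖y‖ ^ 2) :
    ∃ u v : H, ‖u‖ = 1 ∧ ‖u‖ ^ 2 + ‖v‖ ^ 2 = ‖x‖ ^ 2 + ‖y‖ ^ 2 ∧
      InnerProductSpace.rankOne ℂ u u + InnerProductSpace.rankOne ℂ v v =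
        InnerProductSpace.rankOne ℂ x x + InnerProductSpace.rankOne ℂ y y := by
  -- This runs from ‖x‖² ≤ 1 to ‖y‖² ≥ 1, hence takes the value 1.
  let φ : ℝ → ℝ := fun θ => ‖(Real.cos θ : ℂ) • x + (Real.sin θ : ℂ) • y‖ ^ 2
  have hφ : Continuous φ := by fun_prop
  have h0 : φ 0 = ‖x‖ ^ 2 := by simp [φ]
  have h1 : φ (Real.pi / 2) = ‖y‖ ^ 2 := by simp [φ]
  obtain ⟨θ, hθ⟩ := intermediate_value_univ 0 (Real.pi / 2) hφ
    (show (1 : ℝ) ∈ Set.Icc _ _ by rw [h0, h1]; exact ⟨hx, hy⟩)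
  have hcs : (Real.cos θ : ℂ) * Real.cos θ + (Real.sin θ : ℂ) * Real.sin θ = 1 := by
    have := Real.cos_sq_add_sin_sq θ
    rw [sq, sq] at this
    exact_mod_cast this
  set c : ℂ := ((Real.cos θ : ℝ) : ℂ)
  set s : ℂ := ((Real.sin θ : ℝ) : ℂ)
  have hcc : (starRingEnd ℂ) c = c := Complex.conj_ofReal _
  have hsc : (starRingEnd ℂ) s = s := Complex.conj_ofReal _
  refine ⟨c • x + s • y, c • y - s • x, ?_, ?_, ?_⟩
  · exact (pow_eq_one_iff_of_nonneg (norm_nonneg _) two_ne_zero).mp hθ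
  · have h2 : ⟪c • x + s • y, c • x + s • y⟫_ℂ + ⟪c • y - s • x, c • y - s • x⟫_ℂ =
        ⟪x, x⟫_ℂ + ⟪y, y⟫_ℂ := by
      simp only [inner_add_left, inner_add_right, inner_sub_left, inner_sub_right,
        inner_smul_left, inner_smul_right, hcc, hsc]
      linear_combination (⟪x, x⟫_ℂ + ⟪y, y⟫_ℂ) * hcs
    have h3 := congrArg RCLike.re h2
    rw [map_add, map_add] at h3
    simpa only [inner_self_eq_norm_sq (𝕜 := ℂ)] using h3
  · ext z
    simp only [_root_.add_apply, InnerProductSpace.rankOne_apply, inner_add_left, inner_sub_left,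
      inner_smul_left, hcc, hsc, smul_add, smul_sub, smul_smul]
    match_scalars
    · linear_combination ⟪x, z⟫_ℂ * hcs
    · linear_combination ⟪y, z⟫_ℂ * hcs

/-- A family of `N` vectors with `∑ ‖gᵢ‖² = N` can be replaced by a family of unit vectors without
changing the sum of the associated operators of rank one. -/
theorem exists_unit_vectors {ι : Type*} (s : Finset ι) (g : ι → H)
    (hg : ∑ i ∈ s, ‖g i‖ ^ 2 = s.card) :
    ∃ f : ι → H, (∀ i ∈ s, ‖f i‖ = 1) ∧
      ∑ i ∈ s, InnerProductSpace.rankOne ℂ (f i) (f i) =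
        ∑ i ∈ s, InnerProductSpace.rankOne ℂ (g i) (g i) := by
  classical
  induction hn : s.card generalizing s g with
  | zero =>
    rw [Finset.card_eq_zero] at hn
    subst hn
    exact ⟨g, by simp, rfl⟩
  | succ n ih =>
    have hne : s.Nonempty := Finset.card_pos.mp (by omega)
    have hsum : ∑ i ∈ s, ‖g i‖ ^ 2 = ∑ i ∈ s, (1 : ℝ) := by simpa using hg
    -- The squared norms average 1, so one is at most 1 and one at least 1; rotating that pair makes
    -- `g' i` a unit vector to split off.
    obtain ⟨i, hi, hi1⟩ := Finset.exists_le_of_sum_le hne hsum.le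
    obtain ⟨j, hj, hj1⟩ := Finset.exists_le_of_sum_le hne hsum.ge
    have key : ∃ g' : ι → H, ‖g' i‖ = 1 ∧ ∑ l ∈ s, ‖g' l‖ ^ 2 = s.card ∧
        ∑ l ∈ s, InnerProductSpace.rankOne ℂ (g' l) (g' l) =
          ∑ l ∈ s, InnerProductSpace.rankOne ℂ (g l) (g l) := by
      rcases eq_or_ne i j with rfl | hij
      · exact ⟨g, (pow_eq_one_iff_of_nonneg (norm_nonneg _) two_ne_zero).mp (le_antisymm hi1 hj1), hg, rfl⟩
      · obtain ⟨u, v, hu, huv, hop⟩ := exists_rotation (g i) (g j) hi1 hj1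
        let g' : ι → H := Function.update (Function.update g j v) i u
        have hgi : g' i = u := by simp [g']
        have hgj : g' j = v := by simp [g', hij.symm]
        have hgl : ∀ l ∈ (s.erase i).erase j, g' l = g l := fun l hl => by
          rw [Finset.mem_erase, Finset.mem_erase] at hl
          simp [g', hl.1, hl.2.1]
        have hj' : j ∈ s.erase i := Finset.mem_erase.mpr ⟨hij.symm, hj⟩
        refine ⟨g', by rw [hgi, hu], ?_, ?_⟩
        · rw [← hg, ← Finset.add_sum_erase _ _ hi, ← Finset.add_sum_erase _ _ hj',
            ← Finset.add_sum_erase s (fun l => ‖g l‖ ^ 2) hi,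
            ← Finset.add_sum_erase _ (fun l => ‖g l‖ ^ 2) hj', ← add_assoc, ← add_assoc, hgi, hgj,
            huv]
          congr 1
          exact Finset.sum_congr rfl fun l hl => by rw [hgl l hl]
        · rw [← Finset.add_sum_erase _ _ hi, ← Finset.add_sum_erase _ _ hj',
            ← Finset.add_sum_erase s (fun l => InnerProductSpace.rankOne ℂ (g l) (g l)) hi,
            ← Finset.add_sum_erase _ (fun l => InnerProductSpace.rankOne ℂ (g l) (g l)) hj',
            ← add_assoc, ← add_assoc, hgi, hgj, hop]
          congr 1
          exact Finset.sum_congr rfl fun l hl => by rw [hgl l hl]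
    obtain ⟨g', hg'1, hg'2, hg'3⟩ := key
    have hcard : (s.erase i).card = n := by rw [Finset.card_erase_of_mem hi]; omega
    obtain ⟨f, hf1, hf2⟩ := ih (s.erase i) g' (by
      rw [← Finset.add_sum_erase _ _ hi, hg'1, hn] at hg'2
      rw [hcard]
      push_cast at hg'2
      linarith) hcard
    refine ⟨Function.update f i (g' i), fun l hl => ?_, ?_⟩
    · rcases eq_or_ne l i with rfl | hli
      · simpa using hg'1
      · rw [Function.update_of_ne hli]
        exact hf1 l (Finset.mem_erase.mpr ⟨hli, hl⟩)
    · rw [← hg'3, ← Finset.add_sum_erase _ _ hi,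
        ← Finset.add_sum_erase s (fun l => InnerProductSpace.rankOne ℂ (g' l) (g' l)) hi, ← hf2,
        Function.update_self]
      congr 1
      exact Finset.sum_congr rfl fun l hl => by
        rw [Function.update_of_ne (Finset.ne_of_mem_erase hl)]

variable [CompleteSpace H]

/-- A positive operator whose range lies in a finite-dimensional subspace with orthonormal basis
`b` is a sum of operators of rank one indexed by `b`. -/
theorem exists_eq_sum_rankOne {ι : Type*} [Fintype ι] {V : Submodule ℂ H} [FiniteDimensional ℂ V]
    (b : OrthonormalBasis ι ℂ V) {a : H →L[ℂ] H} (ha : a.IsPositive) (hV : ∀ x, a x ∈ V) :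
    ∃ g : ι → H, a = ∑ i, InnerProductSpace.rankOne ℂ (g i) (g i) ∧
      ∀ i, ‖g i‖ ^ 2 = RCLike.re ⟪(b i : H), a (b i)⟫_ℂ := by
  obtain ⟨s, hs, hss, hsn⟩ := exists_sqrt ha
  refine ⟨fun i => s (b i), ?_, fun i => hsn _⟩
  -- Thus s = s P_V, and a = s P_V s expands along the basis `b`.
  have hort : ∀ x, s (x - V.starProjection x) = 0 := by
    intro x
    rw [← norm_eq_zero, ← sq_eq_zero_iff, hsn,
      Submodule.inner_left_of_mem_orthogonal (hV _) (V.sub_starProjection_mem_orthogonal x),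
      map_zero]
  have hsV : ∀ x, s (V.starProjection x) = s x := fun x => by
    rw [eq_comm, ← sub_eq_zero, ← map_sub, hort]
  ext x
  rw [← hss, ← hsV (s x), b.starProjection_eq_sum_rankOne]
  simp [_root_.sum_apply, hs]

/-- A positive operator of finite rank with integral trace becomes a finite sum of projections
after adding the identity. -/
theorem isFiniteSumOfProjections_one_add {k : H →L[ℂ] H} (hk : k.IsPositive)
    (hfin : FiniteDimensional ℂ (LinearMap.range (k : H →ₗ[ℂ] H))) (n : ℕ)
    (hn : opTrace k = n) : IsFiniteSumOfProjections (1 + k) := by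
  let V := LinearMap.range (k : H →ₗ[ℂ] H)
  let b := stdOrthonormalBasis ℂ V
  have hkV : ∀ x, k x ∈ V := fun x => LinearMap.mem_range_self _ x
  have hPpos : V.starProjection.IsPositive :=
    ContinuousLinearMap.IsPositive.of_isStarProjection isStarProjection_starProjection
  obtain ⟨t, hkt, htn⟩ := exists_eq_sum_rankOne b hk hkV
  obtain ⟨g, hag, hgn⟩ := exists_eq_sum_rankOne b (hPpos.add hk)
    fun x => V.add_mem (Submodule.starProjection_apply_mem V x) (hkV x)
  have hst : ∑ i, ‖t i‖ ^ 2 = n := by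
    have h1 : ENNReal.ofReal (∑ i, ‖t i‖ ^ 2) = n := by rw [← opTrace_sum_rankOne, ← hkt, hn]
    rw [← ENNReal.ofReal_natCast] at h1
    exact (ENNReal.ofReal_eq_ofReal_iff (Finset.sum_nonneg fun _ _ => by positivity)
      n.cast_nonneg).mp h1
  have hsg : ∑ i, ‖g i‖ ^ 2 = Module.finrank ℂ V + n := by
    have h1 : ∀ i, ‖g i‖ ^ 2 = 1 + ‖t i‖ ^ 2 := fun i => by
      rw [hgn, htn, _root_.add_apply, inner_add_right, map_add,
        Submodule.starProjection_eq_self_iff.mpr (b i).2, inner_self_eq_norm_sq (𝕜 := ℂ),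
        Submodule.norm_coe, b.orthonormal.1 i, one_pow]
    simp_rw [h1]
    rw [Finset.sum_add_distrib, hst]
    simp
  -- Padding by `n` zero vectors makes the number of vectors equal to ∑ ‖g i‖² = dim V + n.
  let g' : Fin (Module.finrank ℂ V) ⊕ Fin n → H := Sum.elim g 0
  obtain ⟨f, hf1, hf2⟩ := exists_unit_vectors Finset.univ g' (by
    simp [g', Fintype.sum_sum_type, hsg])
  have hA : V.starProjection + k = ∑ i, InnerProductSpace.rankOne ℂ (f i) (f i) := by
    rw [hag, hf2, Fintype.sum_sum_type]
    simp [g']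
  let e := Fintype.equivFin (Option (Fin (Module.finrank ℂ V) ⊕ Fin n))
  let p : Option (Fin (Module.finrank ℂ V) ⊕ Fin n) → H →L[ℂ] H := fun i =>
    i.elim (1 - V.starProjection) fun i => InnerProductSpace.rankOne ℂ (f i) (f i)
  refine ⟨_, fun j => p (e.symm j), fun j => ?_, ?_⟩
  · change IsStarProjection (p (e.symm j))
    rcases e.symm j with _ | i
    · exact IsStarProjection.one_sub (p := V.starProjection) isStarProjection_starProjection
    · exact InnerProductSpace.isStarProjection_rankOne_self (hf1 i (Finset.mem_univ i))
  · rw [Equiv.sum_comp e.symm p, Fintype.sum_option]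
    change _ = (1 - V.starProjection) + ∑ i, InnerProductSpace.rankOne ℂ (f i) (f i)
    rw [← hA]
    abel

end Sufficiency

/-! ### Coordinate embeddings of H ⊕ H. -/

section DirectSum

variable {H : Type*} [NormedAddCommGroup H] [InnerProductSpace ℂ H]

/-- The first coordinate embedding of `H` into `H ⊕ H`. -/
def inlL (H : Type*) [NormedAddCommGroup H] [InnerProductSpace ℂ H] :
    H →L[ℂ] WithLp 2 (H × H) :=
  ((WithLp.prodContinuousLinearEquiv 2 ℂ H H).symm : (H × H) →L[ℂ] WithLp 2 (H × H)) ∘L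
    ContinuousLinearMap.inl ℂ H H

/-- The second coordinate embedding of `H` into `H ⊕ H`. -/
def inrL (H : Type*) [NormedAddCommGroup H] [InnerProductSpace ℂ H] :
    H →L[ℂ] WithLp 2 (H × H) :=
  ((WithLp.prodContinuousLinearEquiv 2 ℂ H H).symm : (H × H) →L[ℂ] WithLp 2 (H × H)) ∘L
    ContinuousLinearMap.inr ℂ H H

theorem inlL_apply (x : H) : inlL H x = WithLp.toLp 2 (x, 0) := rfl

theorem inrL_apply (x : H) : inrL H x = WithLp.toLp 2 (0, x) := rfl

theorem norm_inlL (x : H) : ‖inlL H x‖ = ‖x‖ := by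
  rw [inlL_apply, WithLp.norm_toLp_fst]

theorem norm_inrL (x : H) : ‖inrL H x‖ = ‖x‖ := by
  rw [inrL_apply, WithLp.norm_toLp_snd]

variable [CompleteSpace H]

theorem adjoint_inlL_apply (z : WithLp 2 (H × H)) :
    ContinuousLinearMap.adjoint (inlL H) z = z.fst := by
  refine ext_inner_left ℂ fun y => ?_
  rw [ContinuousLinearMap.adjoint_inner_right, inlL_apply, WithLp.prod_inner_apply]
  simp

theorem adjoint_inrL_apply (z : WithLp 2 (H × H)) :
    ContinuousLinearMap.adjoint (inrL H) z = z.snd := by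
  refine ext_inner_left ℂ fun y => ?_
  rw [ContinuousLinearMap.adjoint_inner_right, inrL_apply, WithLp.prod_inner_apply]
  simp

theorem directSum_neg_eq (a b : H →L[ℂ] H) :
    1 + directSum a (-b) = 1 + inlL H ∘L a ∘L ContinuousLinearMap.adjoint (inlL H) -
      inrL H ∘L b ∘L ContinuousLinearMap.adjoint (inrL H) := by
  rw [add_sub_assoc]
  congr 1
  refine ContinuousLinearMap.ext fun z => ?_
  change directSum a (-b) (WithLp.toLp 2 (z.fst, z.snd)) =
    inlL H (a (ContinuousLinearMap.adjoint (inlL H) z)) -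
      inrL H (b (ContinuousLinearMap.adjoint (inrL H) z))
  rw [directSum_apply, adjoint_inlL_apply, adjoint_inrL_apply, inlL_apply, inrL_apply,
    ← WithLp.toLp_sub]
  simp

end DirectSum

/-! ### Transferring ideals from H ⊕ H back to H. -/

section Ideals

variable {H G : Type*} [NormedAddCommGroup H] [InnerProductSpace ℂ H]
  [NormedAddCommGroup G] [InnerProductSpace ℂ G]

/-- Corners of elements of the ideal generated by `u k v` lie in the ideal generated by `k`. -/
theorem corner_mem_span (k : H →L[ℂ] H) (u : H →L[ℂ] G) (v : G →L[ℂ] H) {x : G →L[ℂ] G}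
    (hx : x ∈ TwoSidedIdeal.span {u ∘L k ∘L v}) (s : G →L[ℂ] H) (r : H →L[ℂ] G) :
    s ∘L x ∘L r ∈ TwoSidedIdeal.span {k} := by
  rw [TwoSidedIdeal.mem_span_iff_mem_addSubgroup_closure] at hx
  induction hx using AddSubgroup.closure_induction with
  | mem x hx =>
    obtain ⟨_, ⟨c, -, _, rfl, rfl⟩, d, -, rfl⟩ := hx
    -- Regrouped, the outer factors are operators on H itself.
    have h1 : s ∘L (c * (u ∘L k ∘L v) * d) ∘L r = (s ∘L c ∘L u) * k * (v ∘L d ∘L r) := rfl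
    refine (congrArg (· ∈ TwoSidedIdeal.span {k}) h1).mpr ?_
    exact TwoSidedIdeal.mul_mem_right _ _ _
      (TwoSidedIdeal.mul_mem_left _ _ _ (TwoSidedIdeal.subset_span rfl))
  | zero => simp
  | add x y _ _ hx hy =>
    rw [ContinuousLinearMap.add_comp, ContinuousLinearMap.comp_add]
    exact add_mem hx hy
  | neg x _ hx =>
    rw [ContinuousLinearMap.neg_comp, ContinuousLinearMap.comp_neg]
    exact neg_mem hx

end Ideals

end FiniteSumsOfProjections

/-! ### The main theorem. -/

open FiniteSumsOfProjections in
theorem corollary5p9 {H : Type*} [NormedAddCommGroup H] [InnerProductSpace ℂ H] [CompleteSpace H]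
    [TopologicalSpace.SeparableSpace H] (hH : ¬ FiniteDimensional ℂ H)
    (k₁ k₂ : H →L[ℂ] H)
    (hk₁ : k₁.IsPositive) (hc₁ : IsCompactOperator k₁) (hn₁ : k₁ ≠ 0)
    (hk₂ : k₂.IsPositive) (hc₂ : IsCompactOperator k₂) (hn₂ : k₂ ≠ 0) :
    (IsFiniteSumOfProjections (1 + k₁) ↔
      FiniteDimensional ℂ k₁.range ∧ ∃ n : ℕ, opTrace k₁ = n) ∧
    (IsFiniteSumOfProjections (1 + directSum k₁ (-k₂)) →
      TwoSidedIdeal.span {k₁} = TwoSidedIdeal.span {k₂} ∧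
      ((∀ x, k₂ x = x → x = 0) →
        opTrace k₁ = ⊤ ∨ ∃ n : ℕ, opTrace k₁ = opTrace k₂ + n)) := by
  refine ⟨⟨fun h => ⟨mem_finiteRank.mp (mem_finiteRank_of_isFiniteSumOfProjections hk₁ hc₁ h), ?_⟩,
    fun ⟨hfin, n, hn⟩ => isFiniteSumOfProjections_one_add hk₁ hfin n hn⟩, fun h => ?_⟩
  · obtain ⟨d, hd⟩ := exists_opTrace_eq_add hk₁ ContinuousLinearMap.isPositive_zero hc₁
      (isCompactOperator_zero (M₂ := H)) (by rwa [sub_zero])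
      fun x hx => eq_zero_of_add_apply_eq_zero hk₁ (by simpa using hx)
    have h0 : opTrace (0 : H →L[ℂ] H) = 0 := by simp [opTrace]
    exact ⟨d, by rw [hd, h0, zero_add]⟩
  · rw [directSum_neg_eq] at h
    set u := inlL H
    set v := inrL H
    set a := u ∘L k₁ ∘L ContinuousLinearMap.adjoint u with ha
    set b := v ∘L k₂ ∘L ContinuousLinearMap.adjoint v with hb
    have hap : a.IsPositive := hk₁.conj_adjoint u
    have hbp : b.IsPositive := hk₂.conj_adjoint v
    have hac : IsCompactOperator a := (hc₁.comp_clm (ContinuousLinearMap.adjoint u)).clm_comp u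
    have hbc : IsCompactOperator b := (hc₂.comp_clm (ContinuousLinearMap.adjoint v)).clm_comp v
    have hka : ContinuousLinearMap.adjoint u ∘L a ∘L u = k₁ := by
      ext x
      simp only [ha, ContinuousLinearMap.comp_apply, u, adjoint_inlL_apply, inlL_apply,
        WithLp.toLp_fst]
    have hkb : ContinuousLinearMap.adjoint v ∘L b ∘L v = k₂ := by
      ext x
      simp only [hb, ContinuousLinearMap.comp_apply, v, adjoint_inrL_apply, inrL_apply,
        WithLp.toLp_snd]
    have ha0 : a ≠ 0 := fun h0 => hn₁ (by rw [← hka, h0]; simp)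
    have hb0 : b ≠ 0 := fun h0 => hn₂ (by rw [← hkb, h0]; simp)
    constructor
    · obtain ⟨hab, hba⟩ := mem_span_of_isFiniteSumOfProjections hap hbp hac hbc ha0 hb0 h
      refine le_antisymm (TwoSidedIdeal.span_le.mpr ?_) (TwoSidedIdeal.span_le.mpr ?_)
      · rw [Set.singleton_subset_iff]
        have := corner_mem_span k₂ v _ hab (ContinuousLinearMap.adjoint u) u
        rwa [hka] at this
      · rw [Set.singleton_subset_iff]
        have := corner_mem_span k₁ u _ hba (ContinuousLinearMap.adjoint v) v
        rwa [hkb] at this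
    · intro h1
      -- The additive identity in [0, ∞] also covers infinite traces.
      right
      obtain ⟨d, hd⟩ := exists_opTrace_eq_add hap hbp hac hbc h fun z hz => by
        have hz' : z + WithLp.toLp 2 (k₁ z.fst, 0) - WithLp.toLp 2 (0, k₂ z.snd) = 0 := by
          rw [← adjoint_inlL_apply, ← adjoint_inrL_apply]
          exact hz
        have hfst : z.fst + k₁ z.fst = 0 := by
          simpa using congrArg WithLp.fst hz'
        have hsnd : z.snd - k₂ z.snd = 0 := by
          simpa using congrArg WithLp.snd hz'
        have hs : z.snd = 0 := h1 _ (sub_eq_zero.mp hsnd).symm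
        have hf : z.fst = 0 := eq_zero_of_add_apply_eq_zero hk₁ hfst
        have : z = WithLp.toLp 2 (z.fst, z.snd) := rfl
        rw [this, hf, hs]
        rfl
      exact ⟨d, by rw [← opTrace_conj hk₁ u norm_inlL, ← opTrace_conj hk₂ v norm_inrL, hd]⟩
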